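/- Let $N_1,N_2$ be connected complete smooth finite-dimensional Riemannian manifolds without boundary, where $N_1$ is not a single point, and let $M=N_1\times N_2$ carry the product metric. Let $V,W:M\to\mathbb R$ be $C^\infty$ functions. Suppose that there are a nonempty open set $\Omega\subset N_1$ and a Lipschitz continuous function $c:\Omega\to\mathbb R$ such that 1. for every $y\in N_2$ the restriction $W|_{\Omega\times\{y\}}$ is constant; 2. $\|d_1V(x,y)\|_{T_x^*N_1}\le c(x)$ for all $(x,y)\in\Omega\times N_2$, where $d_1V(x,y)$ is the differential at $x$ of $V(\cdot,y):N_1\to\mathbb R$. Consider the control system $\dot\lambda=\vec H(t,\lambda)$ on $T^*M$ given by the Hamiltonian $H(t,\lambda)=\tfrac12\|p\|^2+V(x)+u(t)W(x)$ for $\lambda=(p,x)$ with $p\in T_x^*M$, with piecewise constant controls $u$ with values in $\mathbb R$. For $T\ge 0$ let $\mathcal A_{\le T}(\lambda_0)\subset T^*M$ be the set of all points $\lambda(s)$ with $0\le s\le T$, where $\lambda(\cdot)$ is a solution on $[0,s]$ for some such control with $\lambda(0)=\lambda_0$. Let $\pi:T^*M\to M$ be the projection and, with $\inf\emptyset=+\infty$,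 $$T_c=\inf\{T\ge 0:\ \exists\,\Upsilon\subset T^*M\text{ dense such that } \overline{\mathcal A_{\le T}(\lambda_0)}=T^*M\ \text{ for all }\lambda_0\in\Upsilon\},$$ $$T_c^{cs}=\inf\{T\ge 0:\ \exists\,\Upsilon\subset T^*M\text{ dense such that } \pi\big(\overline{\mathcal A_{\le T}(\lambda_0)}\big)=M\ \text{ for all }\lambda_0\in\Upsilon\}.$$ Then $T_c>0$ and $T_c^{cs}>0$. -/

import Mathlib

open Set Filter Topology Bundle Manifold
open scoped NNReal ENNReal ContDiff

namespace HamiltonianControl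

section General

variable {E : Type*} [NormedAddCommGroup E] [NormedSpace ℝ E]
  {H : Type*} [TopologicalSpace H] (I : ModelWithCorners ℝ E H) [I.Boundaryless]
  {M : Type*} [TopologicalSpace M] [ChartedSpace H M] [IsManifold I ∞ M]

/-- The cotangent bundle `T*M`: the vector bundle over `M` whose fibre at `x` is the space of
continuous linear forms on the tangent space at `x`. Its topology is Mathlib's topology on the
total space of a bundle of continuous linear maps. -/
abbrev CotangentBundle (M : Type*) [TopologicalSpace M] [ChartedSpace H M] [IsManifold I ∞ M] :=
  TotalSpace (E →L[ℝ] ℝ) (fun x : M ↦ TangentSpace I x →L[ℝ] Trivial M ℝ x)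

/-- The canonical coordinates `(q, p)` on `T*M` induced by a chart `e` of `M`: `q` is the
coordinate of the base point, and `p` is the covector read in the chart (its pullback under
`e⁻¹`). -/
noncomputable def toCanonical (e : OpenPartialHomeomorph M H) (z : CotangentBundle I M) :
    E × (E →L[ℝ] ℝ) :=
  (e.extend I z.proj,
    ContinuousLinearMap.comp (show TangentSpace I z.proj →L[ℝ] ℝ from z.snd)
      (show E →L[ℝ] TangentSpace I z.proj from
        mfderiv 𝓘(ℝ, E) I (e.extend I).symm (e.extend I z.proj)))

/-- The point of `T*M` with canonical coordinates `(q, p)` in the chart `e`. -/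
noncomputable def ofCanonical (e : OpenPartialHomeomorph M H) (qp : E × (E →L[ℝ] ℝ)) :
    CotangentBundle I M :=
  ⟨(e.extend I).symm qp.1,
    ContinuousLinearMap.comp qp.2
      (show TangentSpace I ((e.extend I).symm qp.1) →L[ℝ] E from
        mfderiv I 𝓘(ℝ, E) (e.extend I) ((e.extend I).symm qp.1))⟩

/-- The curve `γ` in `T*M` satisfies Hamilton's equations `q' = ∂h/∂p`, `p' = -∂h/∂q` of the
Hamiltonian `h` at time `t`, in the canonical coordinates of every smooth chart of `M` around the
base point of `γ t`. The first equation, in which `∂h/∂p` is an element of the bidual of `E`, is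
tested against all covectors `ℓ`. -/
def HamiltonAt (h : CotangentBundle I M → ℝ) (γ : ℝ → CotangentBundle I M) (t : ℝ) : Prop :=
  ∀ e ∈ IsManifold.maximalAtlas I ∞ M, (γ t).proj ∈ e.source →
    ∃ (q' : E) (p' : E →L[ℝ] ℝ),
      HasDerivAt (fun s ↦ toCanonical I e (γ s)) (q', p') t ∧
      (∀ ℓ : E →L[ℝ] ℝ, ℓ q' = fderiv ℝ
        (fun p ↦ h (ofCanonical I e ((toCanonical I e (γ t)).1, p)))
        (toCanonical I e (γ t)).2 ℓ) ∧
      p' = -fderiv ℝ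
        (fun q ↦ h (ofCanonical I e (q, (toCanonical I e (γ t)).2)))
        (toCanonical I e (γ t)).1

/-- A control `u` is piecewise constant: it is locally constant outside a finite set of times. -/
def IsPiecewiseConstant (u : ℝ → ℝ) : Prop :=
  ∃ F : Set ℝ, F.Finite ∧ ∀ t ∉ F, ∀ᶠ s in 𝓝 t, u s = u t

variable [RiemannianBundle (fun x : M ↦ TangentSpace I x)]

/-- The Hamiltonian `‖p‖² / 2 + V x + a * W x`, where `‖·‖` is the dual norm on the cotangent
space of the norm that the Riemannian metric defines on the tangent space. -/
noncomputable def hamiltonian (V W : M → ℝ) (a : ℝ) (z : CotangentBundle I M) : ℝ :=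
  ‖(show TangentSpace I z.proj →L[ℝ] ℝ from z.snd)‖ ^ 2 / 2 + V z.proj + a * W z.proj

/-- `γ` is a solution on `[0, s]` of the control system with the piecewise constant control `u`:
it is continuous, and it satisfies Hamilton's equations at all times at which `u` does not
switch. -/
def IsTrajectory (V W : M → ℝ) (u : ℝ → ℝ) (s : ℝ) (γ : ℝ → CotangentBundle I M) : Prop :=
  ContinuousOn γ (Icc 0 s) ∧
    ∀ t ∈ Ioo 0 s, (∀ᶠ r in 𝓝 t, u r = u t) → HamiltonAt I (hamiltonian I V W (u t)) γ t

/-- The set of the states that are reachable from `z₀` in time at most `T`. -/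
def reachableSet (V W : M → ℝ) (T : ℝ≥0) (z₀ : CotangentBundle I M) :
    Set (CotangentBundle I M) :=
  {z | ∃ s : ℝ, 0 ≤ s ∧ s ≤ T ∧ ∃ u : ℝ → ℝ, IsPiecewiseConstant u ∧
    ∃ γ : ℝ → CotangentBundle I M, IsTrajectory I V W u s γ ∧ γ 0 = z₀ ∧ γ s = z}

/-- The controllability diameter `T_c` (equal to `∞` if no time is admissible). -/
noncomputable def controllabilityDiameter (V W : M → ℝ) : ℝ≥0∞ :=
  ⨅ (T : ℝ≥0) (_ : ∃ Υ : Set (CotangentBundle I M), Dense Υ ∧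
    ∀ z₀ ∈ Υ, closure (reachableSet I V W T z₀) = univ), (T : ℝ≥0∞)

/-- The controllability diameter `T_c^{cs}` in the configuration space (equal to `∞` if no time is
admissible). -/
noncomputable def configurationDiameter (V W : M → ℝ) : ℝ≥0∞ :=
  ⨅ (T : ℝ≥0) (_ : ∃ Υ : Set (CotangentBundle I M), Dense Υ ∧
    ∀ z₀ ∈ Υ, TotalSpace.proj '' closure (reachableSet I V W T z₀) = univ), (T : ℝ≥0∞)

end General

section Product

variable {E₁ : Type*} [NormedAddCommGroup E₁] [NormedSpace ℝ E₁]
  {H₁ : Type*} [TopologicalSpace H₁] {I₁ : ModelWithCorners ℝ E₁ H₁}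
  {N₁ : Type*} [TopologicalSpace N₁] [ChartedSpace H₁ N₁]
  [h₁ : RiemannianBundle (fun x : N₁ ↦ TangentSpace I₁ x)]
  {E₂ : Type*} [NormedAddCommGroup E₂] [NormedSpace ℝ E₂]
  {H₂ : Type*} [TopologicalSpace H₂] {I₂ : ModelWithCorners ℝ E₂ H₂}
  {N₂ : Type*} [TopologicalSpace N₂] [ChartedSpace H₂ N₂]
  [h₂ : RiemannianBundle (fun y : N₂ ↦ TangentSpace I₂ y)]

/-- The product metric `g((v₁, v₂), (w₁, w₂)) = g₁(v₁, w₁) + g₂(v₂, w₂)` as a bilinear form on the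
tangent space `E₁ × E₂` of `N₁ × N₂` at `z`. -/
noncomputable def prodInner (z : N₁ × N₂) : (E₁ × E₂) →L[ℝ] (E₁ × E₂) →L[ℝ] ℝ :=
  ContinuousLinearMap.bilinearComp (show E₁ →L[ℝ] E₁ →L[ℝ] ℝ from h₁.g.inner z.1)
      (ContinuousLinearMap.fst ℝ E₁ E₂) (ContinuousLinearMap.fst ℝ E₁ E₂) +
    ContinuousLinearMap.bilinearComp (show E₂ →L[ℝ] E₂ →L[ℝ] ℝ from h₂.g.inner z.2)
      (ContinuousLinearMap.snd ℝ E₁ E₂) (ContinuousLinearMap.snd ℝ E₁ E₂)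

theorem prodInner_apply (z : N₁ × N₂) (v w : E₁ × E₂) :
    prodInner (I₁ := I₁) (I₂ := I₂) z v w =
      h₁.g.inner z.1 v.1 w.1 + h₂.g.inner z.2 v.2 w.2 := rfl

theorem metric_self_nonneg {B : Type*} {E : B → Type*} [∀ b, TopologicalSpace (E b)]
    [∀ b, AddCommGroup (E b)] [∀ b, Module ℝ (E b)] (g : RiemannianMetric E) (b : B) (v : E b) :
    0 ≤ g.inner b v v := by
  rcases eq_or_ne v 0 with rfl | hv
  · simp
  · exact (g.pos b v hv).le

/-- The product Riemannian structure on `N₁ × N₂`. -/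
noncomputable instance prodRiemannianBundle :
    RiemannianBundle (fun z : N₁ × N₂ ↦ TangentSpace (I₁.prod I₂) z) where
  g :=
    { inner := fun z ↦ prodInner (I₁ := I₁) (I₂ := I₂) z
      symm := fun z v w ↦ by
        change h₁.g.inner z.1 v.1 w.1 + h₂.g.inner z.2 v.2 w.2 =
          h₁.g.inner z.1 w.1 v.1 + h₂.g.inner z.2 w.2 v.2
        exact congrArg₂ (· + ·) (h₁.g.symm z.1 v.1 w.1) (h₂.g.symm z.2 v.2 w.2)
      pos := fun z v hv ↦ by
        change 0 < h₁.g.inner z.1 v.1 v.1 + h₂.g.inner z.2 v.2 v.2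
        by_cases h : v.1 = 0
        · have h' : v.2 ≠ 0 := fun h' ↦ hv (Prod.ext h h')
          exact add_pos_of_nonneg_of_pos (metric_self_nonneg _ _ _) (h₂.g.pos _ _ h')
        · exact add_pos_of_pos_of_nonneg (h₁.g.pos _ _ h) (metric_self_nonneg _ _ _)
      continuousAt := fun z ↦ by
        let B := prodInner (I₁ := I₁) (I₂ := I₂) z
        change ContinuousAt (fun v : E₁ × E₂ ↦ B v v) 0
        fun_prop
      isVonNBounded := fun z ↦ by
        change Bornology.IsVonNBounded ℝ
          {v : E₁ × E₂ | h₁.g.inner z.1 v.1 v.1 + h₂.g.inner z.2 v.2 v.2 < 1}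
        have b₁ : Bornology.IsVonNBounded ℝ {v : E₁ | h₁.g.inner z.1 v v < 1} :=
          h₁.g.isVonNBounded z.1
        have b₂ : Bornology.IsVonNBounded ℝ {v : E₂ | h₂.g.inner z.2 v v < 1} :=
          h₂.g.isVonNBounded z.2
        rw [NormedSpace.isVonNBounded_iff] at b₁ b₂ ⊢
        refine (b₁.prod b₂).subset fun v hv ↦ ⟨?_, ?_⟩
        · exact lt_of_le_of_lt (le_add_of_nonneg_right (metric_self_nonneg h₂.g z.2 v.2)) hv
        · exact lt_of_le_of_lt (le_add_of_nonneg_left (metric_self_nonneg h₁.g z.1 v.1)) hv }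

end Product

/-- The differential `d₁V (x, y)` at `x` of the function `V (·, y)`, a covector on `N₁`. -/
noncomputable def partialDifferential {E₁ : Type*} [NormedAddCommGroup E₁] [NormedSpace ℝ E₁]
    {H₁ : Type*} [TopologicalSpace H₁] (I₁ : ModelWithCorners ℝ E₁ H₁)
    {N₁ : Type*} [TopologicalSpace N₁] [ChartedSpace H₁ N₁] {N₂ : Type*}
    (V : N₁ × N₂ → ℝ) (x : N₁) (y : N₂) : TangentSpace I₁ x →L[ℝ] ℝ :=
  mfderiv I₁ 𝓘(ℝ, ℝ) (fun x' ↦ V (x', y)) x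

end HamiltonianControl

/-!
Over `Ω` the controlled potential `W`
does not depend on the first variable, so the control enters neither equation of Hamilton's system
for the `N₁`-component `(x₁, p₁)`, and the metric does not couple the factors. The remaining force
`d₁V` is bounded near a point `x₀` of `Ω`, uniformly in the second variable. Hence a first
component that starts near the zero covector at `x₀` needs a time bounded below to leave a
small ball around it, for every control and every motion of the second component. Such initial
states form a nonempty open set, which meets every dense set, and `N₁` has a point `x₁` outside the
ball. So neither time can be smaller than this bound.

No covariant derivative is needed: the estimate is made in one fixed chart of `N₁`, with an
arbitrary chart of `N₂` around the current point. Half the squared dual norm is the Legendre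
transform of half the metric (`isLUB_half_sq_norm`). This shows that the kinetic energy splits over
the product (`chartKinetic_prod`) and that it is locally Lipschitz in the canonical coordinates of
the first factor (`exists_chartKinetic_lipschitz`). Lipschitz bounds on the Hamiltonian are all that
Hamilton's equations require to bound the velocity of the first component
(`exists_hasDerivAt_firstState`). A first exit time argument, with a mean value inequality that
ignores the finitely many switching times, gives `exists_reachable_subset_stateBall`, from which
`configurationDiameter_pos` follows. The bound passes to the phase space by
`configurationDiameter_le`.
-/

namespace HamiltonianControl

/-! ### Legendre transforms of quadratic functions -/

/-- Half the square of the dual norm is the Legendre transform of half the square of the norm. -/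
theorem isLUB_half_sq_norm {F : Type*} [NormedAddCommGroup F] [NormedSpace ℝ F] (p : F →L[ℝ] ℝ) :
    IsLUB (range fun v ↦ p v - ‖v‖ ^ 2 / 2) (‖p‖ ^ 2 / 2) := by
  refine ⟨?_, fun b hb ↦ ?_⟩
  · rintro _ ⟨v, rfl⟩
    have := (le_abs_self _).trans (p.le_opNorm v)
    nlinarith [sq_nonneg (‖p‖ - ‖v‖)]
  · have hb' : ∀ v, p v - ‖v‖ ^ 2 / 2 ≤ b := fun v ↦ hb ⟨v, rfl⟩
    have hb0 : 0 ≤ b := by simpa using hb' 0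
    have key : ‖p‖ ≤ √(2 * b) := by
      refine p.opNorm_le_bound (Real.sqrt_nonneg _) fun v ↦ ?_
      rcases eq_or_ne v 0 with rfl | hv
      · simp
      have hv' : 0 < ‖v‖ := norm_pos_iff.2 hv
      -- The multiple of `v` that maximizes `p v - ‖v‖ ^ 2 / 2`.
      have h := hb' ((p v / ‖v‖ ^ 2) • v)
      rw [map_smul, norm_smul, mul_pow, Real.norm_eq_abs, sq_abs, smul_eq_mul] at h
      have h2 : p v ^ 2 ≤ 2 * b * ‖v‖ ^ 2 := by
        field_simp at h
        nlinarith
      rw [Real.norm_eq_abs, ← Real.sqrt_sq hv'.le, ← Real.sqrt_mul (by positivity)]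
      exact Real.abs_le_sqrt h2
    have := pow_le_pow_left₀ (norm_nonneg _) key 2
    rw [Real.sq_sqrt (by positivity)] at this
    linarith

theorem isLUB_range_add {α β : Type*} {f : α → ℝ} {g : β → ℝ} {a b : ℝ}
    (hf : IsLUB (range f) a) (hg : IsLUB (range g) b) :
    IsLUB (range fun z : α × β ↦ f z.1 + g z.2) (a + b) := by
  refine ⟨?_, fun c hc ↦ ?_⟩
  · rintro _ ⟨z, rfl⟩
    exact add_le_add (hf.1 ⟨_, rfl⟩) (hg.1 ⟨_, rfl⟩)
  · have h : ∀ y, a ≤ c - g y := fun y ↦ hf.2 (by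
      rintro _ ⟨x, rfl⟩
      have : f x + g y ≤ c := hc ⟨(x, y), rfl⟩
      linarith)
    have h2 : b ≤ c - a := hg.2 (by
      rintro _ ⟨y, rfl⟩
      linarith [h y])
    linarith

section
variable {E : Type*} [NormedAddCommGroup E] [NormedSpace ℝ E]

/-- Comparison of the Legendre transforms of two quadratic functions `N / 2`, `N' / 2`. Coercivity
of `N` confines the supremum to `‖v‖ ≤ 2 * R / α`, where the two functions differ by a controlled
amount. -/
theorem legendre_le {N N' : E → ℝ} {p p' : E →L[ℝ] ℝ} {K K' α δ R : ℝ} (hα : 0 < α)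
    (hδ : 0 ≤ δ)
    (hK : IsLUB (range fun v ↦ p v - N v / 2) K) (hK' : IsLUB (range fun v ↦ p' v - N' v / 2) K')
    (hN : ∀ v, α * ‖v‖ ^ 2 ≤ N v) (hN' : N' 0 = 0) (hNN' : ∀ v, |N v - N' v| ≤ δ * ‖v‖ ^ 2)
    (hp : ‖p‖ ≤ R) :
    K ≤ K' + (2 * R / α * ‖p - p'‖ + (2 * R / α) ^ 2 / 2 * δ) := by
  have hR : 0 ≤ R := (norm_nonneg _).trans hp
  have hρ : 0 ≤ 2 * R / α := by positivity
  refine hK.2 ?_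
  rintro _ ⟨v, rfl⟩
  have h0 : 0 ≤ K' := by simpa [hN'] using hK'.1 ⟨0, rfl⟩
  have hv : p' v - N' v / 2 ≤ K' := hK'.1 ⟨v, rfl⟩
  have hpv : p v ≤ R * ‖v‖ :=
    (le_abs_self _).trans ((p.le_opNorm v).trans (by gcongr))
  have hn := norm_nonneg v
  rcases le_or_gt ‖v‖ (2 * R / α) with h | h
  -- Within the radius the two expressions are compared at the same vector `v`.
  · have h1 : p v - p' v ≤ ‖p - p'‖ * ‖v‖ := (le_abs_self _).trans ((p - p').le_opNorm v)
    have h2 : ‖p - p'‖ * ‖v‖ ≤ ‖p - p'‖ * (2 * R / α) := by gcongr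
    have h3 : δ * ‖v‖ ^ 2 ≤ δ * (2 * R / α) ^ 2 := by gcongr
    have h4 := abs_le.1 (hNN' v)
    linarith [h4.1]
  -- Beyond the radius coercivity makes the left side negative, and `0 ≤ K'`.
  · rw [div_lt_iff₀ hα] at h
    have h1 := hN v
    have h2 : 0 ≤ 2 * R / α * ‖p - p'‖ + (2 * R / α) ^ 2 / 2 * δ := by positivity
    have h3 : 2 * R * ‖v‖ ≤ ‖v‖ * α * ‖v‖ := by gcongr
    dsimp only
    nlinarith

theorem abs_legendre_sub_le {N N' : E → ℝ} {p p' : E →L[ℝ] ℝ} {K K' α δ R : ℝ} (hα : 0 < α)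
    (hδ : 0 ≤ δ)
    (hK : IsLUB (range fun v ↦ p v - N v / 2) K) (hK' : IsLUB (range fun v ↦ p' v - N' v / 2) K')
    (hN : ∀ v, α * ‖v‖ ^ 2 ≤ N v) (hN' : ∀ v, α * ‖v‖ ^ 2 ≤ N' v)
    (h0 : N 0 = 0) (h0' : N' 0 = 0) (hNN' : ∀ v, |N v - N' v| ≤ δ * ‖v‖ ^ 2)
    (hp : ‖p‖ ≤ R) (hp' : ‖p'‖ ≤ R) :
    |K - K'| ≤ 2 * R / α * ‖p - p'‖ + (2 * R / α) ^ 2 / 2 * δ := by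
  have h1 := legendre_le hα hδ hK hK' hN h0' hNN' hp
  have h2 := legendre_le hα hδ hK' hK hN' h0 (fun v ↦ by rw [abs_sub_comm]; exact hNN' v) hp'
  rw [norm_sub_rev] at h2
  rw [abs_le]
  constructor <;> linarith

/-! ### Mean value inequalities -/

theorem norm_sub_le_of_hasDerivAt_Ioo {f : ℝ → E} {C a b : ℝ} (hab : a ≤ b)
    (hf : ContinuousOn f (Icc a b))
    (hf' : ∀ t ∈ Ioo a b, ∃ f', HasDerivAt f f' t ∧ ‖f'‖ ≤ C) : ‖f b - f a‖ ≤ C * (b - a) := by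
  rcases hab.eq_or_lt with rfl | hab
  · simp
  choose! f' h1 h2 using hf'
  have hC : 0 ≤ C := by
    obtain ⟨t, ht⟩ := nonempty_Ioo.2 hab
    exact (norm_nonneg _).trans (h2 t ht)
  refine NormedSpace.norm_le_dual_bound ℝ _ (by have := sub_pos.2 hab; positivity) fun ℓ ↦ ?_
  obtain ⟨t, ht, h⟩ := exists_hasDerivAt_eq_slope (fun t ↦ ℓ (f t)) (fun t ↦ ℓ (f' t)) hab
    (ℓ.continuous.comp_continuousOn hf)
    fun t ht ↦ ℓ.hasFDerivAt.comp_hasDerivAt t (h1 t ht)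
  have hba : 0 < b - a := sub_pos.2 hab
  rw [eq_div_iff hba.ne'] at h
  rw [map_sub, ← h, norm_mul, Real.norm_of_nonneg hba.le]
  have h3 := ℓ.le_opNorm_of_le (h2 t ht)
  calc ‖ℓ (f' t)‖ * (b - a) ≤ (‖ℓ‖ * C) * (b - a) := by gcongr
    _ = C * (b - a) * ‖ℓ‖ := by ring

/-- Mean value inequality for a continuous curve that is differentiable, with derivative bounded
by `C`, outside a finite set of times. -/
theorem norm_sub_le_of_hasDerivAt_off_finite {f : ℝ → E} {C : ℝ} (F : Finset ℝ) :
    ∀ {a b : ℝ}, a ≤ b → ContinuousOn f (Icc a b) →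
    (∀ t ∈ Ioo a b, t ∉ F → ∃ f', HasDerivAt f f' t ∧ ‖f'‖ ≤ C) →
    ‖f b - f a‖ ≤ C * (b - a) := by
  induction F using Finset.induction_on with
  | empty =>
    exact fun hab hf hf' ↦ norm_sub_le_of_hasDerivAt_Ioo hab hf fun t ht ↦ hf' t ht (by simp)
  | insert c F _ ih =>
    intro a b hab hf hf'
    by_cases hc : c ∈ Ioo a b
    · have h1 := ih hc.1.le (hf.mono (Icc_subset_Icc_right hc.2.le)) fun t ht htF ↦
        hf' t ⟨ht.1, ht.2.trans hc.2⟩ (by simp [ht.2.ne, htF])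
      have h2 := ih hc.2.le (hf.mono (Icc_subset_Icc_left hc.1.le)) fun t ht htF ↦
        hf' t ⟨hc.1.trans ht.1, ht.2⟩ (by simp [ht.1.ne', htF])
      have h3 := norm_sub_le_norm_sub_add_norm_sub (f b) (f c) (f a)
      linarith
    · exact ih hab hf fun t ht htF ↦ hf' t ht (by
        rw [Finset.mem_insert, not_or]; exact ⟨fun h ↦ hc (h ▸ ht), htF⟩)

/-- A Lipschitz bound along a line bounds the derivative in its direction. Differentiability is
not needed, since `fderiv` is zero where it fails. -/
theorem abs_fderiv_apply_le {f : E → ℝ} {x v : E} {K : ℝ} (hK : 0 ≤ K)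
    (h : ∀ᶠ s in 𝓝 (0 : ℝ), |f (x + s • v) - f x| ≤ K * |s|) : |fderiv ℝ f x v| ≤ K := by
  by_cases hf : DifferentiableAt ℝ f x
  · have := hf.hasFDerivAt.hasLineDerivAt v
    refine HasDerivAt.le_of_lip' this hK ?_
    simpa using h
  · simpa [fderiv_zero_of_not_differentiableAt hf] using hK

end

/-! ### The metric in a chart -/

section
variable {E : Type*} [NormedAddCommGroup E] [NormedSpace ℝ E]

set_option synthInstance.maxHeartbeats 200000 in
/-- A `C¹` family of quadratic forms that is positive definite at `q₀` is uniformly coercive,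
bounded and Lipschitz in the parameter near `q₀`. -/
theorem exists_quadratic_bounds {G : E → E →L[ℝ] E →L[ℝ] ℝ} {q₀ : E} (hG : ContDiffAt ℝ 1 G q₀)
    {a : ℝ} (ha : 0 < a) (hlow : ∀ v, a * ‖v‖ ^ 2 ≤ G q₀ v v) :
    ∃ α > 0, ∃ β ≥ 0, ∃ L ≥ 0, ∃ s ∈ 𝓝 q₀,
      (∀ q ∈ s, ∀ v, α * ‖v‖ ^ 2 ≤ G q v v) ∧ (∀ q ∈ s, ∀ v, G q v v ≤ β * ‖v‖ ^ 2) ∧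
      ∀ q ∈ s, ∀ q' ∈ s, ∀ v, |G q v v - G q' v v| ≤ L * ‖q - q'‖ * ‖v‖ ^ 2 := by
  obtain ⟨K, s, hs, hK⟩ := hG.exists_lipschitzOnWith
  have hc : ∀ᶠ q in 𝓝 q₀, ‖G q - G q₀‖ < min (a / 2) 1 := by
    have h := hG.continuousAt
    rw [Metric.continuousAt_iff'] at h
    simpa only [dist_eq_norm] using h (min (a / 2) 1) (by positivity)
  have hbd : ∀ (B : E →L[ℝ] E →L[ℝ] ℝ) (v : E), |B v v| ≤ ‖B‖ * ‖v‖ ^ 2 := fun B v ↦ by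
    rw [pow_two, ← mul_assoc]
    exact B.le_opNorm₂ v v
  refine ⟨a / 2, by positivity, ‖G q₀‖ + 1, by positivity, K, K.2,
    s ∩ {q | ‖G q - G q₀‖ < min (a / 2) 1},
    inter_mem hs hc, fun q hq v ↦ ?_, fun q hq v ↦ ?_, fun q hq q' hq' v ↦ ?_⟩
  · have h1 := hlow v
    have h2 := abs_le.1 (hbd (G q - G q₀) v)
    have h3 : ‖G q - G q₀‖ * ‖v‖ ^ 2 ≤ a / 2 * ‖v‖ ^ 2 := by
      gcongr
      exact (lt_min_iff.1 (show ‖G q - G q₀‖ < min (a / 2) 1 from hq.2)).1.le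
    have h4 : (G q - G q₀) v v = G q v v - G q₀ v v := rfl
    linarith [h2.1]
  · refine (le_abs_self _).trans ((hbd _ v).trans ?_)
    gcongr
    have := norm_sub_norm_le (G q) (G q₀)
    linarith [(lt_min_iff.1 (show ‖G q - G q₀‖ < min (a / 2) 1 from hq.2)).2]
  · refine (hbd (G q - G q') v).trans ?_
    gcongr
    exact hK.norm_sub_le hq.1 hq'.1

end

section
variable {E : Type*} [NormedAddCommGroup E] [NormedSpace ℝ E]
  {H : Type*} [TopologicalSpace H] (I : ModelWithCorners ℝ E H)
  {M : Type*} [TopologicalSpace M] [ChartedSpace H M]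

/-- The derivative of the inverse of the extended chart at `x₀`, as a map from the model space `E`
to the tangent space at the point with coordinate `q`. -/
noncomputable def chartFrame (x₀ : M) (q : E) :
    E →L[ℝ] TangentSpace I ((extChartAt I x₀).symm q) :=
  mfderiv 𝓘(ℝ, E) I (extChartAt I x₀).symm q

/-- The derivative at `x` of the extended chart at `x₀`, as a map from the tangent space at `x` to
the model space `E`. -/
noncomputable def chartCoframe (x₀ x : M) : TangentSpace I x →L[ℝ] E :=
  mfderiv I 𝓘(ℝ, E) (extChartAt I x₀) x

variable {I}

theorem chartCoframe_chartFrame [I.Boundaryless] [IsManifold I 1 M] {x₀ : M} {q : E}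
    (hq : q ∈ (extChartAt I x₀).target) (v : E) :
    chartCoframe I x₀ ((extChartAt I x₀).symm q) (chartFrame I x₀ q v) = v := by
  have h := mfderiv_extChartAt_comp_mfderivWithin_extChartAt_symm hq
  rw [I.range_eq_univ, mfderivWithin_univ] at h
  exact DFunLike.congr_fun h v

theorem chartFrame_chartCoframe [I.Boundaryless] [IsManifold I 1 M] {x₀ : M} {q : E}
    (hq : q ∈ (extChartAt I x₀).target) (w : TangentSpace I ((extChartAt I x₀).symm q)) :
    chartFrame I x₀ q (chartCoframe I x₀ ((extChartAt I x₀).symm q) w) = w := by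
  have h := mfderivWithin_extChartAt_symm_comp_mfderiv_extChartAt hq
  rw [I.range_eq_univ, mfderivWithin_univ] at h
  exact DFunLike.congr_fun h w

variable [RiemannianBundle (fun x : M ↦ TangentSpace I x)]

variable (I) in
/-- The Riemannian metric in the chart at `x₀`: the squared length of the tangent vector with
coordinates `v` at the point with coordinate `q`. -/
noncomputable def chartSqNorm (x₀ : M) (q v : E) : ℝ := ‖chartFrame I x₀ q v‖ ^ 2

/-- The squared dual norm of a covector depends only on its coordinates `p` and on the metric read
in the chart. -/
theorem isLUB_chart_kinetic [I.Boundaryless] [IsManifold I 1 M] {x₀ : M} {q : E}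
    (hq : q ∈ (extChartAt I x₀).target) (p : E →L[ℝ] ℝ) :
    IsLUB (range fun v ↦ p v - chartSqNorm I x₀ q v / 2)
      (‖p.comp (chartCoframe I x₀ ((extChartAt I x₀).symm q))‖ ^ 2 / 2) := by
  convert isLUB_half_sq_norm (p.comp (chartCoframe I x₀ ((extChartAt I x₀).symm q))) using 1
  ext r
  constructor
  · rintro ⟨v, rfl⟩
    refine ⟨chartFrame I x₀ q v, ?_⟩
    exact congrArg (fun u ↦ p u - chartSqNorm I x₀ q v / 2) (chartCoframe_chartFrame hq v)
  · rintro ⟨w, rfl⟩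
    refine ⟨chartCoframe I x₀ _ w, ?_⟩
    exact congrArg (fun u ↦ p (chartCoframe I x₀ _ w) - ‖u‖ ^ 2 / 2) (chartFrame_chartCoframe hq w)

theorem chartSqNorm_zero (x₀ : M) (q : E) : chartSqNorm I x₀ q 0 = 0 := by
  have h : chartFrame I x₀ q 0 = 0 := (chartFrame I x₀ q).map_zero
  rw [chartSqNorm, h, norm_zero, zero_pow two_ne_zero]

/-- The metric read in a chart is a `C¹` family of bilinear forms on the model space. -/
theorem exists_chartMetric [I.Boundaryless] [IsManifold I 2 M]
    [IsContMDiffRiemannianBundle I 1 E (fun x : M ↦ TangentSpace I x)] (x₀ : M) :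
    ∃ G : E → E →L[ℝ] E →L[ℝ] ℝ, ContDiffAt ℝ 1 G (extChartAt I x₀ x₀) ∧
      ∀ q ∈ (extChartAt I x₀).target, ∀ v, chartSqNorm I x₀ q v = G q v v := by
  have : IsManifold I 1 M := .of_le one_le_two
  have : IsManifold I (1 + 1) M := by rwa [one_add_one_eq_two]
  obtain ⟨g, hg, hgi⟩ := IsContMDiffRiemannianBundle.exists_contMDiff (IB := I) (n := 1) (F := E)
    (E := fun x : M ↦ TangentSpace I x)
  have h1 := (contMDiffAt_hom_bundle _).1 (hg x₀)
  have h2 := h1.2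
  let G' : M → E →L[ℝ] E →L[ℝ] ℝ := fun x ↦ ContinuousLinearMap.inCoordinates E
    (fun x : M ↦ TangentSpace I x) (E →L[ℝ] ℝ) (fun x : M ↦ TangentSpace I x →L[ℝ] ℝ)
    x₀ x x₀ x (g x)
  have hG' : ContMDiffAt I 𝓘(ℝ, E →L[ℝ] E →L[ℝ] ℝ) 1 G' x₀ := h2
  refine ⟨G' ∘ (extChartAt I x₀).symm, ?_, fun q hq v ↦ ?_⟩
  · rw [← contMDiffAt_iff_contDiffAt]
    have h3 : ContMDiffAt 𝓘(ℝ, E) I 1 (extChartAt I x₀).symm (extChartAt I x₀ x₀) := by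
      have := contMDiffWithinAt_extChartAt_symm_range (I := I) (n := 1) x₀
        (mem_extChartAt_target x₀)
      rwa [I.range_eq_univ, contMDiffWithinAt_univ] at this
    exact ContMDiffAt.comp_of_eq (x := extChartAt I x₀ x₀) hG' h3 (extChartAt_to_inv x₀)
  · have hs : (extChartAt I x₀).symm q ∈ (extChartAt I x₀).source := (extChartAt I x₀).map_target hq
    rw [extChartAt_source] at hs
    have hb : (extChartAt I x₀).symm q ∈
        (trivializationAt E (fun x : M ↦ TangentSpace I x) x₀).baseSet := hs
    have e1 : G' ((extChartAt I x₀).symm q) v v = g ((extChartAt I x₀).symm q)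
        ((trivializationAt E (fun x : M ↦ TangentSpace I x) x₀).symm _ v)
        ((trivializationAt E (fun x : M ↦ TangentSpace I x) x₀).symm _ v) := by
      have h := inCoordinates_apply_eq₂ (𝕜 := ℝ) (F₃ := ℝ) (E₃ := Bundle.Trivial M ℝ)
        (ϕ := g ((extChartAt I x₀).symm q)) (v := v) (w := v) hb hb (mem_univ _)
      exact h.trans (DFunLike.congr_fun (Trivial.linearMapAt_trivialization ℝ M ℝ _) _)
    have e2 : (trivializationAt E (fun x : M ↦ TangentSpace I x) x₀).symm
        ((extChartAt I x₀).symm q) v = chartFrame I x₀ q v := by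
      have h := TangentBundle.symmL_trivializationAt (𝕜 := ℝ) (I := I) hs
      rw [I.range_eq_univ, mfderivWithin_univ, (extChartAt I x₀).right_inv hq] at h
      exact (Trivialization.symmL_apply (R := ℝ) _ hb v).symm.trans (DFunLike.congr_fun h v)
    rw [Function.comp_apply, e1, e2, ← hgi, real_inner_self_eq_norm_sq]
    rfl

theorem exists_chartSqNorm_bounds [I.Boundaryless] [IsManifold I 2 M]
    [IsContMDiffRiemannianBundle I 1 E (fun x : M ↦ TangentSpace I x)] (x₀ : M) :
    ∃ α > 0, ∃ β ≥ 0, ∃ L ≥ 0, ∃ s ∈ 𝓝 (extChartAt I x₀ x₀), s ⊆ (extChartAt I x₀).target ∧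
      (∀ q ∈ s, ∀ v, α * ‖v‖ ^ 2 ≤ chartSqNorm I x₀ q v) ∧
      (∀ q ∈ s, ∀ v, chartSqNorm I x₀ q v ≤ β * ‖v‖ ^ 2) ∧
      ∀ q ∈ s, ∀ q' ∈ s, ∀ v,
        |chartSqNorm I x₀ q v - chartSqNorm I x₀ q' v| ≤ L * ‖q - q'‖ * ‖v‖ ^ 2 := by
  have : IsManifold I 1 M := .of_le one_le_two
  obtain ⟨G, hG, hGN⟩ := exists_chartMetric (I := I) x₀
  have ht : (extChartAt I x₀).target ∈ 𝓝 (extChartAt I x₀ x₀) := extChartAt_target_mem_nhds x₀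
  let A := chartCoframe I x₀ ((extChartAt I x₀).symm (extChartAt I x₀ x₀))
  have hlow : ∀ v, ((‖A‖ + 1) ^ 2)⁻¹ * ‖v‖ ^ 2 ≤ G (extChartAt I x₀ x₀) v v := fun v ↦ by
    have h1 : A (chartFrame I x₀ (extChartAt I x₀ x₀) v) = v :=
      chartCoframe_chartFrame (mem_extChartAt_target x₀) v
    have h2 : ‖v‖ ≤ (‖A‖ + 1) * ‖chartFrame I x₀ (extChartAt I x₀ x₀) v‖ := by
      have := A.le_opNorm (chartFrame I x₀ (extChartAt I x₀ x₀) v)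
      rw [h1] at this
      linarith [norm_nonneg (chartFrame I x₀ (extChartAt I x₀ x₀) v)]
    rw [← hGN _ (mem_extChartAt_target x₀), inv_mul_le_iff₀ (by positivity), chartSqNorm,
      ← mul_pow]
    gcongr
  obtain ⟨α, hα, β, hβ, L, hL, s, hs, h1, h2, h3⟩ :=
    exists_quadratic_bounds hG (by positivity) hlow
  refine ⟨α, hα, β, hβ, L, hL, s ∩ (extChartAt I x₀).target, inter_mem hs ht,
    inter_subset_right, fun q hq v ↦ ?_, fun q hq v ↦ ?_, fun q hq q' hq' v ↦ ?_⟩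
  · rw [hGN q hq.2]
    exact h1 q hq.1 v
  · rw [hGN q hq.2]
    exact h2 q hq.1 v
  · rw [hGN q hq.2, hGN q' hq'.2]
    exact h3 q hq.1 q' hq'.1 v

end

/-! ### Canonical coordinates on the cotangent bundle -/

section
variable {E : Type*} [NormedAddCommGroup E] [NormedSpace ℝ E]
  {H : Type*} [TopologicalSpace H] {I : ModelWithCorners ℝ E H} [I.Boundaryless]
  {M : Type*} [TopologicalSpace M] [ChartedSpace H M] [IsManifold I ∞ M]

/-- The canonical coordinates of a preferred chart are the coordinates of the trivialization of
the cotangent bundle. This gives their continuity for the topology of the total space. -/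
theorem toCanonical_chartAt (x₀ : M) (z : CotangentBundle I M)
    (hz : z.proj ∈ (chartAt H x₀).source) :
    toCanonical I (chartAt H x₀) z = (extChartAt I x₀ z.proj,
      (trivializationAt (E →L[ℝ] ℝ) (fun x : M ↦ TangentSpace I x →L[ℝ] Trivial M ℝ x) x₀ z).2) := by
  have : IsManifold I 1 M := .of_le (n := ∞) (by simp)
  refine Prod.ext rfl ?_
  ext v
  have h := TangentBundle.symmL_trivializationAt (𝕜 := ℝ) (I := I) hz
  rw [I.range_eq_univ, mfderivWithin_univ] at h
  rw [hom_trivializationAt_apply]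
  simp only [ContinuousLinearMap.inCoordinates, Trivial.continuousLinearMapAt_trivialization,
    Trivial.fiberBundle_trivializationAt']
  exact congrArg (fun w ↦ z.snd w) (DFunLike.congr_fun h v).symm

theorem continuousAt_toCanonical (x₀ : M) (z : CotangentBundle I M)
    (hz : z.proj ∈ (chartAt H x₀).source) :
    ContinuousAt (toCanonical I (chartAt H x₀)) z := by
  have : IsManifold I 1 M := .of_le (n := ∞) (by simp)
  have hp : Continuous (TotalSpace.proj : CotangentBundle I M → M) :=
    FiberBundle.continuous_proj (E →L[ℝ] ℝ) (fun x : M ↦ TangentSpace I x →L[ℝ] Trivial M ℝ x)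
  have hU : ∀ᶠ w in 𝓝 z, w.proj ∈ (chartAt H x₀).source :=
    hp.continuousAt.eventually ((chartAt H x₀).open_source.mem_nhds hz)
  refine ContinuousAt.congr (f := fun w ↦ (extChartAt I x₀ w.proj,
      (trivializationAt (E →L[ℝ] ℝ) (fun x : M ↦ TangentSpace I x →L[ℝ] Trivial M ℝ x) x₀ w).2)) ?_
    (hU.mono fun w hw ↦ (toCanonical_chartAt x₀ w hw).symm)
  refine ContinuousAt.prodMk ?_ ?_
  · exact ContinuousAt.comp (f := TotalSpace.proj)
      (continuousAt_extChartAt' (by rwa [extChartAt_source])) hp.continuousAt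
  · refine continuousAt_snd.comp (OpenPartialHomeomorph.continuousAt _ ?_)
    rw [Trivialization.mem_source]
    exact ⟨hz, mem_univ _⟩
end

/-! ### Lipschitz estimates in a chart -/

section
variable {E : Type*} [NormedAddCommGroup E] [NormedSpace ℝ E]
  {H : Type*} [TopologicalSpace H] (I : ModelWithCorners ℝ E H) [I.Boundaryless]
  {M : Type*} [TopologicalSpace M] [ChartedSpace H M]
  [RiemannianBundle (fun x : M ↦ TangentSpace I x)]

/-- The kinetic energy in canonical coordinates `(q, p)` of the chart at `x₀`: half the squared
dual norm of the covector with coordinates `p` at the point with coordinate `q`. -/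
noncomputable def chartKinetic (x₀ : M) (q : E) (p : E →L[ℝ] ℝ) : ℝ :=
  ‖p.comp (chartCoframe I x₀ ((extChartAt I x₀).symm q))‖ ^ 2 / 2

variable {I}

theorem exists_chartKinetic_lipschitz [IsManifold I 2 M]
    [IsContMDiffRiemannianBundle I 1 E (fun x : M ↦ TangentSpace I x)] (x₀ : M) (R : ℝ) :
    ∃ C ≥ 0, ∃ s ∈ 𝓝 (extChartAt I x₀ x₀), ∀ q ∈ s, ∀ q' ∈ s, ∀ p p' : E →L[ℝ] ℝ,
      ‖p‖ ≤ R → ‖p'‖ ≤ R →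
      |chartKinetic I x₀ q p - chartKinetic I x₀ q' p'| ≤ C * (‖p - p'‖ + ‖q - q'‖) := by
  have : IsManifold I 1 M := .of_le one_le_two
  obtain ⟨α, hα, β, hβ, L, hL, s, hs, hst, h1, -, h3⟩ := exists_chartSqNorm_bounds (I := I) x₀
  refine ⟨max (2 * R / α) ((2 * R / α) ^ 2 / 2 * L), le_max_of_le_right (by positivity), s, hs,
    fun q hq q' hq' p p' hp hp' ↦ ?_⟩
  have h := abs_legendre_sub_le hα (δ := L * ‖q - q'‖) (by positivity)
    (isLUB_chart_kinetic (hst hq) p) (isLUB_chart_kinetic (hst hq') p') (h1 q hq) (h1 q' hq')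
    (chartSqNorm_zero x₀ q) (chartSqNorm_zero x₀ q') (h3 q hq q' hq') hp hp'
  refine h.trans ?_
  rw [mul_add]
  refine add_le_add (by gcongr; exact le_max_left _ _) ?_
  rw [← mul_assoc]
  gcongr
  exact le_max_right _ _

/-- A family of functions whose differentials have Riemannian norm bounded uniformly near `x₀` is
uniformly Lipschitz in the chart at `x₀`. -/
theorem exists_lipschitz_in_chart [IsManifold I 2 M]
    [IsContMDiffRiemannianBundle I 1 E (fun x : M ↦ TangentSpace I x)] {x₀ : M} {Y : Type*}
    {f : Y → M → ℝ} {f' : Y → ∀ x, TangentSpace I x →L[ℝ] ℝ}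
    (hf : ∀ y x, HasMFDerivAt I 𝓘(ℝ, ℝ) (f y) x (f' y x)) {C : ℝ}
    (hC : ∀ᶠ x in 𝓝 x₀, ∀ y, ‖f' y x‖ ≤ C) :
    ∃ K ≥ 0, ∃ s ∈ 𝓝 (extChartAt I x₀ x₀), ∀ y, ∀ q ∈ s, ∀ q' ∈ s,
      |f y ((extChartAt I x₀).symm q) - f y ((extChartAt I x₀).symm q')| ≤ K * ‖q - q'‖ := by
  have : IsManifold I 1 M := .of_le one_le_two
  obtain ⟨α, hα, β, hβ, L, hL, s, hs, hst, -, h2, -⟩ := exists_chartSqNorm_bounds (I := I) x₀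
  have hcont : Tendsto (extChartAt I x₀).symm (𝓝 (extChartAt I x₀ x₀)) (𝓝 x₀) := by
    have := continuousAt_extChartAt_symm (I := I) x₀
    rwa [ContinuousAt, extChartAt_to_inv] at this
  obtain ⟨r, hr, hrs⟩ := Metric.mem_nhds_iff.1 (inter_mem hs (hcont.eventually hC))
  refine ⟨|C| * √β, by positivity, _, Metric.ball_mem_nhds _ hr, fun y q hq q' hq' ↦ ?_⟩
  have hd : ∀ z ∈ Metric.ball (extChartAt I x₀ x₀) r,
      HasFDerivAt (fun z ↦ f y ((extChartAt I x₀).symm z))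
        ((f' y ((extChartAt I x₀).symm z)).comp (chartFrame I x₀ z)) z := by
    intro z hz
    have h3 := mdifferentiableWithinAt_extChartAt_symm (hst (hrs hz).1)
    rw [I.range_eq_univ, mdifferentiableWithinAt_univ] at h3
    exact ((hf y _).comp z h3.hasMFDerivAt).hasFDerivAt
  refine (convex_ball (extChartAt I x₀ x₀) r).norm_image_sub_le_of_norm_hasFDerivWithin_le
    (f := fun z ↦ f y ((extChartAt I x₀).symm z))
    (fun z hz ↦ (hd z hz).hasFDerivWithinAt) (fun z hz ↦ ?_) hq' hq
  refine ContinuousLinearMap.opNorm_le_bound _ (by positivity) fun v ↦ ?_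
  have h4 : ‖chartFrame I x₀ z v‖ ≤ √β * ‖v‖ := by
    have h5 : ‖chartFrame I x₀ z v‖ ^ 2 ≤ β * ‖v‖ ^ 2 := h2 z (hrs hz).1 v
    rw [← Real.sqrt_sq (norm_nonneg v), ← Real.sqrt_mul hβ]
    exact Real.le_sqrt_of_sq_le h5
  have h6 : ‖f' y ((extChartAt I x₀).symm z)‖ ≤ |C| :=
    ((hrs hz).2 y).trans (le_abs_self C)
  have h7 := (f' y ((extChartAt I x₀).symm z)).le_opNorm (chartFrame I x₀ z v)
  refine h7.trans ?_
  rw [mul_assoc]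
  gcongr

end

/-! ### Canonical coordinates on a product -/

section Product

variable {E₁ : Type*} [NormedAddCommGroup E₁] [NormedSpace ℝ E₁]
  {E₂ : Type*} [NormedAddCommGroup E₂] [NormedSpace ℝ E₂]
  {N₁ : Type*} [TopologicalSpace N₁] [ChartedSpace E₁ N₁] [IsManifold 𝓘(ℝ, E₁) ∞ N₁]
  {N₂ : Type*} [TopologicalSpace N₂] [ChartedSpace E₂ N₂] [IsManifold 𝓘(ℝ, E₂) ∞ N₂]

local notation "I₁₂" => ModelWithCorners.prod 𝓘(ℝ, E₁) 𝓘(ℝ, E₂)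

theorem chartFrame_prod {x₀ : N₁} {y₀ : N₂} {q₁ : E₁} {q₂ : E₂}
    (h₁ : q₁ ∈ (extChartAt 𝓘(ℝ, E₁) x₀).target) (h₂ : q₂ ∈ (extChartAt 𝓘(ℝ, E₂) y₀).target)
    (v : E₁ × E₂) :
    chartFrame I₁₂ (x₀, y₀) (q₁, q₂) v =
      (chartFrame 𝓘(ℝ, E₁) x₀ q₁ v.1, chartFrame 𝓘(ℝ, E₂) y₀ q₂ v.2) := by
  have : IsManifold 𝓘(ℝ, E₁) 1 N₁ := .of_le (n := ∞) (by simp)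
  have : IsManifold 𝓘(ℝ, E₂) 1 N₂ := .of_le (n := ∞) (by simp)
  have d₁ := mdifferentiableWithinAt_extChartAt_symm h₁
  have d₂ := mdifferentiableWithinAt_extChartAt_symm h₂
  rw [ModelWithCorners.range_eq_univ, mdifferentiableWithinAt_univ] at d₁ d₂
  have f₁ : HasMFDerivAt 𝓘(ℝ, E₁ × E₂) 𝓘(ℝ, E₁) Prod.fst (q₁, q₂)
      (ContinuousLinearMap.fst ℝ E₁ E₂) :=
    hasFDerivAt_fst.hasMFDerivAt
  have f₂ : HasMFDerivAt 𝓘(ℝ, E₁ × E₂) 𝓘(ℝ, E₂) Prod.snd (q₁, q₂)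
      (ContinuousLinearMap.snd ℝ E₁ E₂) :=
    hasFDerivAt_snd.hasMFDerivAt
  have h := (HasMFDerivAt.comp (q₁, q₂) d₁.hasMFDerivAt f₁).prodMk
    (HasMFDerivAt.comp (q₁, q₂) d₂.hasMFDerivAt f₂)
  have h' : (extChartAt I₁₂ (x₀, y₀)).symm = fun z : E₁ × E₂ ↦ ((extChartAt 𝓘(ℝ, E₁) x₀).symm z.1,
    (extChartAt 𝓘(ℝ, E₂) y₀).symm z.2) := by
    rw [extChartAt_prod]; rfl
  have h'' := h.mfderiv
  exact DFunLike.congr_fun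
    (h'' : mfderiv 𝓘(ℝ, E₁ × E₂) I₁₂ (extChartAt I₁₂ (x₀, y₀)).symm (q₁, q₂) = _) v

variable [RiemannianBundle (fun x : N₁ ↦ TangentSpace 𝓘(ℝ, E₁) x)]
  [RiemannianBundle (fun y : N₂ ↦ TangentSpace 𝓘(ℝ, E₂) y)]

theorem chartSqNorm_prod {x₀ : N₁} {y₀ : N₂} {q₁ : E₁} {q₂ : E₂}
    (h₁ : q₁ ∈ (extChartAt 𝓘(ℝ, E₁) x₀).target) (h₂ : q₂ ∈ (extChartAt 𝓘(ℝ, E₂) y₀).target)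
    (v : E₁ × E₂) :
    chartSqNorm I₁₂ (x₀, y₀) (q₁, q₂) v =
      chartSqNorm 𝓘(ℝ, E₁) x₀ q₁ v.1 + chartSqNorm 𝓘(ℝ, E₂) y₀ q₂ v.2 := by
  rw [chartSqNorm, chartSqNorm, chartSqNorm, ← real_inner_self_eq_norm_sq,
    ← real_inner_self_eq_norm_sq, ← real_inner_self_eq_norm_sq, chartFrame_prod h₁ h₂]
  rfl

/-- The kinetic energy of a product metric is the sum of the kinetic energies of the factors. The
suprema over `v₁` and `v₂` in the Legendre transform are independent of each other. -/
theorem chartKinetic_prod {x₀ : N₁} {y₀ : N₂} {q₁ : E₁} {q₂ : E₂}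
    (h₁ : q₁ ∈ (extChartAt 𝓘(ℝ, E₁) x₀).target) (h₂ : q₂ ∈ (extChartAt 𝓘(ℝ, E₂) y₀).target)
    (p : E₁ × E₂ →L[ℝ] ℝ) :
    chartKinetic I₁₂ (x₀, y₀) (q₁, q₂) p =
      chartKinetic 𝓘(ℝ, E₁) x₀ q₁ (p.comp (ContinuousLinearMap.inl ℝ E₁ E₂)) +
      chartKinetic 𝓘(ℝ, E₂) y₀ q₂ (p.comp (ContinuousLinearMap.inr ℝ E₁ E₂)) := by
  have : IsManifold 𝓘(ℝ, E₁) 1 N₁ := .of_le (n := ∞) (by simp)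
  have : IsManifold 𝓘(ℝ, E₂) 1 N₂ := .of_le (n := ∞) (by simp)
  have hq : (q₁, q₂) ∈ (extChartAt I₁₂ (x₀, y₀)).target := by
    rw [extChartAt_prod]; exact ⟨h₁, h₂⟩
  refine (isLUB_chart_kinetic hq p).unique ?_
  have hadd : (fun v ↦ p v - chartSqNorm I₁₂ (x₀, y₀) (q₁, q₂) v / 2) = fun v ↦
      ((p.comp (ContinuousLinearMap.inl ℝ E₁ E₂)) v.1 - chartSqNorm 𝓘(ℝ, E₁) x₀ q₁ v.1 / 2) +
      ((p.comp (ContinuousLinearMap.inr ℝ E₁ E₂)) v.2 - chartSqNorm 𝓘(ℝ, E₂) y₀ q₂ v.2 / 2) := by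
    ext v
    have hp : p v = p (v.1, 0) + p (0, v.2) := by rw [← map_add]; simp
    rw [chartSqNorm_prod h₁ h₂, hp]
    simp only [ContinuousLinearMap.comp_apply, ContinuousLinearMap.inl_apply,
      ContinuousLinearMap.inr_apply]
    ring
  rw [hadd]
  exact isLUB_range_add (isLUB_chart_kinetic h₁ _) (isLUB_chart_kinetic h₂ _)

theorem hamiltonian_ofCanonical {x₀ : N₁} {y₀ : N₂} {q₁ : E₁} {q₂ : E₂}
    (h₁ : q₁ ∈ (extChartAt 𝓘(ℝ, E₁) x₀).target) (h₂ : q₂ ∈ (extChartAt 𝓘(ℝ, E₂) y₀).target)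
    (p : E₁ × E₂ →L[ℝ] ℝ) (V W : N₁ × N₂ → ℝ) (a : ℝ) :
    hamiltonian I₁₂ V W a (ofCanonical I₁₂ (chartAt (ModelProd E₁ E₂) (x₀, y₀)) ((q₁, q₂), p)) =
      chartKinetic 𝓘(ℝ, E₁) x₀ q₁ (p.comp (ContinuousLinearMap.inl ℝ E₁ E₂)) +
      chartKinetic 𝓘(ℝ, E₂) y₀ q₂ (p.comp (ContinuousLinearMap.inr ℝ E₁ E₂)) +
      V ((extChartAt 𝓘(ℝ, E₁) x₀).symm q₁, (extChartAt 𝓘(ℝ, E₂) y₀).symm q₂) +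
      a * W ((extChartAt 𝓘(ℝ, E₁) x₀).symm q₁, (extChartAt 𝓘(ℝ, E₂) y₀).symm q₂) := by
  rw [← chartKinetic_prod h₁ h₂]
  rfl

end Product

/-! ### The motion of the first component -/

section Motion

variable {E₁ : Type*} [NormedAddCommGroup E₁] [NormedSpace ℝ E₁]
  {E₂ : Type*} [NormedAddCommGroup E₂] [NormedSpace ℝ E₂]
  {N₁ : Type*} [TopologicalSpace N₁] [ChartedSpace E₁ N₁] [IsManifold 𝓘(ℝ, E₁) ∞ N₁]
  {N₂ : Type*} [TopologicalSpace N₂] [ChartedSpace E₂ N₂] [IsManifold 𝓘(ℝ, E₂) ∞ N₂]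

local notation "I₁₂" => ModelWithCorners.prod 𝓘(ℝ, E₁) 𝓘(ℝ, E₂)

/-- The canonical coordinates `(q₁, p₁)`, in the chart of `N₁` at `x₀`, of the `N₁`-component of a
point of `T*(N₁ × N₂)`. No chart of `N₂` enters, so that they follow a trajectory however far its
second component travels. -/
noncomputable def firstState (x₀ : N₁) (z : CotangentBundle I₁₂ (N₁ × N₂)) :
    E₁ × (E₁ →L[ℝ] ℝ) :=
  (extChartAt 𝓘(ℝ, E₁) x₀ z.proj.1,
    ((show E₁ × E₂ →L[ℝ] ℝ from z.snd).comp (ContinuousLinearMap.inl ℝ E₁ E₂)).comp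
      (show E₁ →L[ℝ] E₁ from chartFrame 𝓘(ℝ, E₁) x₀ (extChartAt 𝓘(ℝ, E₁) x₀ z.proj.1)))

/-- The linear projection `((q₁, q₂), p) ↦ (q₁, p₁)`, where `p₁` is the restriction of `p` to the
first factor. -/
noncomputable def firstPart (E₁ E₂ : Type*) [NormedAddCommGroup E₁] [NormedSpace ℝ E₁]
    [NormedAddCommGroup E₂] [NormedSpace ℝ E₂] :
    (E₁ × E₂) × (E₁ × E₂ →L[ℝ] ℝ) →L[ℝ] E₁ × (E₁ →L[ℝ] ℝ) :=
  (ContinuousLinearMap.fst ℝ E₁ E₂).prodMap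
    ((ContinuousLinearMap.compL ℝ E₁ (E₁ × E₂) ℝ).flip (ContinuousLinearMap.inl ℝ E₁ E₂))

theorem firstPart_apply (w : (E₁ × E₂) × (E₁ × E₂ →L[ℝ] ℝ)) :
    firstPart E₁ E₂ w = (w.1.1, w.2.comp (ContinuousLinearMap.inl ℝ E₁ E₂)) := rfl

theorem firstPart_toCanonical (x₀ : N₁) (y₀ : N₂) (z : CotangentBundle I₁₂ (N₁ × N₂))
    (h₁ : z.proj.1 ∈ (chartAt E₁ x₀).source) (h₂ : z.proj.2 ∈ (chartAt E₂ y₀).source) :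
    firstPart E₁ E₂ (toCanonical I₁₂ (chartAt (ModelProd E₁ E₂) (x₀, y₀)) z) = firstState x₀ z := by
  rw [firstPart_apply]
  refine Prod.ext rfl (ContinuousLinearMap.ext fun v ↦ ?_)
  have t₁ : extChartAt 𝓘(ℝ, E₁) x₀ z.proj.1 ∈ (extChartAt 𝓘(ℝ, E₁) x₀).target :=
    (extChartAt 𝓘(ℝ, E₁) x₀).map_source (by rwa [extChartAt_source])
  have t₂ : extChartAt 𝓘(ℝ, E₂) y₀ z.proj.2 ∈ (extChartAt 𝓘(ℝ, E₂) y₀).target :=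
    (extChartAt 𝓘(ℝ, E₂) y₀).map_source (by rwa [extChartAt_source])
  have h := chartFrame_prod t₁ t₂ (v, 0)
  have h0 : chartFrame 𝓘(ℝ, E₂) y₀ (extChartAt 𝓘(ℝ, E₂) y₀ z.proj.2) 0 = 0 :=
    (chartFrame 𝓘(ℝ, E₂) y₀ (extChartAt 𝓘(ℝ, E₂) y₀ z.proj.2)).map_zero
  rw [h0] at h
  exact congrArg (fun w ↦ z.snd w) h

theorem continuous_proj_cotangentBundle :
    Continuous (TotalSpace.proj : CotangentBundle I₁₂ (N₁ × N₂) → N₁ × N₂) := by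
  have : IsManifold I₁₂ 1 (N₁ × N₂) := .of_le (n := ∞) (by simp)
  exact FiberBundle.continuous_proj (E₁ × E₂ →L[ℝ] ℝ)
    (fun x : N₁ × N₂ ↦ TangentSpace I₁₂ x →L[ℝ] Trivial (N₁ × N₂) ℝ x)

theorem eventually_firstPart_toCanonical (x₀ : N₁) (z : CotangentBundle I₁₂ (N₁ × N₂))
    (h₁ : z.proj.1 ∈ (chartAt E₁ x₀).source) :
    ∀ᶠ w in 𝓝 z, firstPart E₁ E₂ (toCanonical I₁₂ (chartAt (ModelProd E₁ E₂) (x₀, z.proj.2)) w) =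
      firstState x₀ w := by
  have hU := continuous_proj_cotangentBundle.continuousAt.eventually
    (prod_mem_nhds ((chartAt E₁ x₀).open_source.mem_nhds h₁)
      ((chartAt E₂ z.proj.2).open_source.mem_nhds (mem_chart_source E₂ z.proj.2)))
  exact hU.mono fun w hw ↦ firstPart_toCanonical x₀ _ w hw.1 hw.2

theorem continuousAt_firstState (x₀ : N₁) (z : CotangentBundle I₁₂ (N₁ × N₂))
    (h₁ : z.proj.1 ∈ (chartAt E₁ x₀).source) : ContinuousAt (firstState x₀) z := by
  refine ContinuousAt.congr ?_ (eventually_firstPart_toCanonical x₀ z h₁)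
  exact (firstPart E₁ E₂).continuous.continuousAt.comp
    (continuousAt_toCanonical (x₀, z.proj.2) z ⟨h₁, mem_chart_source E₂ z.proj.2⟩)

variable [RiemannianBundle (fun x : N₁ ↦ TangentSpace 𝓘(ℝ, E₁) x)]
  [RiemannianBundle (fun y : N₂ ↦ TangentSpace 𝓘(ℝ, E₂) y)]

/-- Where `W` does not depend on the first variable, Hamilton's equations bound the velocity of
the first component independently of the control value `a`. In the product chart the Hamiltonian
is the sum of the kinetic energy of `(q₁, p₁)`, of the kinetic energy of `(q₂, p₂)`, of `V` and of
`a * W`. Only the first and the third depend on `(q₁, p₁)`. -/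
theorem exists_hasDerivAt_firstState {V W : N₁ × N₂ → ℝ} {x₀ : N₁} {s : Set E₁}
    (hs : IsOpen s) (hst : s ⊆ (extChartAt 𝓘(ℝ, E₁) x₀).target) {C D R : ℝ} (hC : 0 ≤ C)
    (hD : 0 ≤ D)
    (hkin : ∀ q ∈ s, ∀ q' ∈ s, ∀ p p' : E₁ →L[ℝ] ℝ, ‖p‖ ≤ R → ‖p'‖ ≤ R →
      |chartKinetic 𝓘(ℝ, E₁) x₀ q p - chartKinetic 𝓘(ℝ, E₁) x₀ q' p'| ≤
        C * (‖p - p'‖ + ‖q - q'‖))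
    (hV : ∀ y, ∀ q ∈ s, ∀ q' ∈ s, |V ((extChartAt 𝓘(ℝ, E₁) x₀).symm q, y) -
      V ((extChartAt 𝓘(ℝ, E₁) x₀).symm q', y)| ≤ D * ‖q - q'‖)
    (hW : ∀ y, ∀ q ∈ s, ∀ q' ∈ s, W ((extChartAt 𝓘(ℝ, E₁) x₀).symm q, y) =
      W ((extChartAt 𝓘(ℝ, E₁) x₀).symm q', y))
    {γ : ℝ → CotangentBundle I₁₂ (N₁ × N₂)} {t a : ℝ} (hγ : ContinuousAt γ t)
    (h₁ : (γ t).proj.1 ∈ (chartAt E₁ x₀).source) (hq : (firstState x₀ (γ t)).1 ∈ s)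
    (hp : ‖(firstState x₀ (γ t)).2‖ < R)
    (hH : HamiltonAt I₁₂ (hamiltonian I₁₂ V W a) γ t) :
    ∃ f', HasDerivAt (fun t ↦ firstState x₀ (γ t)) f' t ∧ ‖f'‖ ≤ C + D := by
  set y₀ := (γ t).proj.2 with hy₀
  have hsrc : (γ t).proj.2 ∈ (chartAt E₂ y₀).source := mem_chart_source E₂ y₀
  obtain ⟨q', p', hd, hq', hp'⟩ := hH (chartAt (ModelProd E₁ E₂) (x₀, y₀))
    (IsManifold.chart_mem_maximalAtlas _) ⟨h₁, hsrc⟩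
  have hfs := firstPart_toCanonical x₀ y₀ (γ t) h₁ hsrc
  rw [← hfs] at hq hp
  set w := toCanonical I₁₂ (chartAt (ModelProd E₁ E₂) (x₀, y₀)) (γ t) with hw
  obtain ⟨⟨q₁, q₂⟩, p⟩ := w
  rw [firstPart_apply] at hq hp
  simp only at hq hp hq' hp'
  have t₂ : q₂ ∈ (extChartAt 𝓘(ℝ, E₂) y₀).target := by
    have : q₂ = extChartAt 𝓘(ℝ, E₂) y₀ (γ t).proj.2 := congrArg (fun w ↦ w.1.2) hw
    rw [this]
    exact (extChartAt 𝓘(ℝ, E₂) y₀).map_source (by rwa [extChartAt_source])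
  refine ⟨firstPart E₁ E₂ (q', p'), ?_, ?_⟩
  · refine ((firstPart E₁ E₂).hasFDerivAt.comp_hasDerivAt t hd).congr_of_eventuallyEq ?_
    exact (hγ.eventually (eventually_firstPart_toCanonical x₀ (γ t) h₁)).mono fun _ h ↦ h.symm
  rw [firstPart_apply]
  refine max_le ?_ ?_
  · refine (?_ : _ ≤ C).trans (by linarith)
    refine NormedSpace.norm_le_dual_bound ℝ _ hC fun ℓ ↦ ?_
    have h := hq' (ℓ.comp (ContinuousLinearMap.fst ℝ E₁ E₂))
    rw [show ℓ q'.1 = (ℓ.comp (ContinuousLinearMap.fst ℝ E₁ E₂)) q' from rfl, h]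
    refine abs_fderiv_apply_le (by positivity) ?_
    have hcont : ContinuousAt (fun r : ℝ ↦
        ‖p.comp (ContinuousLinearMap.inl ℝ E₁ E₂) + r • ℓ‖) 0 := by fun_prop
    have hev : ∀ᶠ r : ℝ in 𝓝 0, ‖p.comp (ContinuousLinearMap.inl ℝ E₁ E₂) + r • ℓ‖ < R :=
      hcont.eventually_lt continuousAt_const (by simpa using hp)
    filter_upwards [hev] with r hr
    rw [hamiltonian_ofCanonical (hst hq) t₂, hamiltonian_ofCanonical (hst hq) t₂]
    have e₁ : (p + r • ℓ.comp (ContinuousLinearMap.fst ℝ E₁ E₂)).comp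
        (ContinuousLinearMap.inl ℝ E₁ E₂) = p.comp (ContinuousLinearMap.inl ℝ E₁ E₂) + r • ℓ := by
      ext v; simp
    have e₂ : (p + r • ℓ.comp (ContinuousLinearMap.fst ℝ E₁ E₂)).comp
        (ContinuousLinearMap.inr ℝ E₁ E₂) = p.comp (ContinuousLinearMap.inr ℝ E₁ E₂) := by
      ext v; simp
    rw [e₁, e₂]
    have hk := hkin q₁ hq q₁ hq _ _ hr.le hp.le
    rw [add_sub_cancel_left, norm_smul, sub_self, norm_zero, add_zero, Real.norm_eq_abs] at hk
    rw [add_sub_add_right_eq_sub, add_sub_add_right_eq_sub, add_sub_add_right_eq_sub]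
    exact hk.trans_eq (by ring)
  · refine ContinuousLinearMap.opNorm_le_bound _ (by positivity) fun v ↦ ?_
    rw [hp']
    have e₀ : ∀ L : E₁ × E₂ →L[ℝ] ℝ, ‖((-L).comp (ContinuousLinearMap.inl ℝ E₁ E₂)) v‖ =
        |L (v, 0)| := fun L ↦ by simp
    refine (e₀ _).trans_le (abs_fderiv_apply_le (by positivity) ?_)
    have hcont : ContinuousAt (fun r : ℝ ↦ q₁ + r • v) 0 := by fun_prop
    have hev : ∀ᶠ r : ℝ in 𝓝 0, q₁ + r • v ∈ s :=
      hcont.eventually (hs.mem_nhds (by simpa using hq))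
    filter_upwards [hev] with r hr
    have e₁ : (q₁, q₂) + r • (v, (0 : E₂)) = (q₁ + r • v, q₂) := by simp
    rw [e₁, hamiltonian_ofCanonical (hst hr) t₂, hamiltonian_ofCanonical (hst hq) t₂,
      hW _ _ hr _ hq, add_sub_add_right_eq_sub]
    have hk := hkin _ hr q₁ hq _ _ hp.le hp.le
    have hv := hV ((extChartAt 𝓘(ℝ, E₂) y₀).symm q₂) _ hr _ hq
    rw [sub_self, norm_zero, zero_add, add_sub_cancel_left, norm_smul, Real.norm_eq_abs] at hk
    rw [add_sub_cancel_left, norm_smul, Real.norm_eq_abs] at hv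
    rw [abs_le] at hk hv ⊢
    constructor <;> linarith [hk.1, hk.2, hv.1, hv.2]

end Motion

/-! ### Confinement of the first component -/

section Confinement

variable {E₁ : Type*} [NormedAddCommGroup E₁] [NormedSpace ℝ E₁]
  {E₂ : Type*} [NormedAddCommGroup E₂] [NormedSpace ℝ E₂]
  {N₁ : Type*} [TopologicalSpace N₁] [ChartedSpace E₁ N₁] [IsManifold 𝓘(ℝ, E₁) ∞ N₁]
  {N₂ : Type*} [TopologicalSpace N₂] [ChartedSpace E₂ N₂] [IsManifold 𝓘(ℝ, E₂) ∞ N₂]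

local notation "I₁₂" => ModelWithCorners.prod 𝓘(ℝ, E₁) 𝓘(ℝ, E₂)

variable (E₂ N₂) in
/-- The points of `T*(N₁ × N₂)` whose `N₁`-component has canonical coordinates at distance less
than `r` (for the maximum of the norms of position and covector) from the zero covector at `x₀`. -/
def stateBall (x₀ : N₁) (r : ℝ) : Set (CotangentBundle I₁₂ (N₁ × N₂)) :=
  {z | z.proj.1 ∈ (chartAt E₁ x₀).source ∧
    firstState x₀ z ∈ Metric.ball (extChartAt 𝓘(ℝ, E₁) x₀ x₀, 0) r}

theorem isOpen_stateBall (x₀ : N₁) (r : ℝ) : IsOpen (stateBall (E₁ := E₁) E₂ N₂ x₀ r) := by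
  rw [isOpen_iff_mem_nhds]
  intro z hz
  exact inter_mem (continuous_proj_cotangentBundle.continuousAt.preimage_mem_nhds
      (prod_mem_nhds ((chartAt E₁ x₀).open_source.mem_nhds hz.1) univ_mem) |> fun h ↦
        mem_of_superset h fun w hw ↦ hw.1)
    ((continuousAt_firstState x₀ z hz.1).preimage_mem_nhds (Metric.isOpen_ball.mem_nhds hz.2))

theorem stateBall_nonempty [Nonempty N₂] (x₀ : N₁) {r : ℝ} (hr : 0 < r) :
    (stateBall (E₁ := E₁) E₂ N₂ x₀ r).Nonempty := by
  obtain ⟨y⟩ := ‹Nonempty N₂›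
  refine ⟨⟨(x₀, y), 0⟩, mem_chart_source E₁ x₀, ?_⟩
  have : firstState x₀ (⟨(x₀, y), 0⟩ : CotangentBundle I₁₂ (N₁ × N₂)) =
      (extChartAt 𝓘(ℝ, E₁) x₀ x₀, 0) := Prod.ext rfl (ContinuousLinearMap.ext fun v ↦ rfl)
  rw [this]
  exact Metric.mem_ball_self hr

/-- A curve whose first component moves with speed at most `C`, as long as it remains in the ball
of radius `r`, is still in it at time `s ≤ r / (4 * C)` if it starts in the ball of radius
`r / 2`. -/
theorem mem_stateBall_of_deriv_bound [FiniteDimensional ℝ E₁] [T2Space N₁] {x₀ : N₁} {r C s : ℝ}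
    (hC : 0 ≤ C) (hball : Metric.ball (extChartAt 𝓘(ℝ, E₁) x₀ x₀) r ⊆
      (extChartAt 𝓘(ℝ, E₁) x₀).target)
    {γ : ℝ → CotangentBundle I₁₂ (N₁ × N₂)} (hγ : ContinuousOn γ (Icc 0 s)) (hs : 0 ≤ s)
    (hCs : C * s ≤ r / 4) (F : Finset ℝ)
    (hd : ∀ t ∈ Ioo 0 s, t ∉ F → γ t ∈ stateBall E₂ N₂ x₀ r →
      ∃ f', HasDerivAt (fun t ↦ firstState x₀ (γ t)) f' t ∧ ‖f'‖ ≤ C)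
    (h0 : γ 0 ∈ stateBall E₂ N₂ x₀ (r / 2)) : γ s ∈ stateBall E₂ N₂ x₀ r := by
  have hr : 0 < r := by
    have := Metric.pos_of_mem_ball h0.2
    linarith
  by_contra hcon
  -- The first exit time is the infimum of the closed set of the times outside the ball.
  let A : Set ℝ := Icc 0 s ∩ γ ⁻¹' (stateBall E₂ N₂ x₀ r)ᶜ
  have hAc : IsClosed A :=
    hγ.preimage_isClosed_of_isClosed isClosed_Icc (isOpen_stateBall x₀ r).isClosed_compl
  have hAb : BddBelow A := ⟨0, fun t ht ↦ ht.1.1⟩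
  have hτ : sInf A ∈ A := hAc.csInf_mem ⟨s, ⟨hs, le_rfl⟩, hcon⟩ hAb
  set τ := sInf A
  have hbefore : ∀ t ∈ Ico 0 τ, γ t ∈ stateBall E₂ N₂ x₀ r := fun t ht ↦ by
    by_contra h
    exact ht.2.not_ge (csInf_le hAb ⟨⟨ht.1, ht.2.le.trans hτ.1.2⟩, h⟩)
  have hτ0 : 0 < τ := by
    refine hτ.1.1.lt_of_ne fun h ↦ hτ.2 ?_
    rw [← h]
    exact ⟨h0.1, Metric.ball_subset_ball (by linarith) h0.2⟩
  set c : E₁ × (E₁ →L[ℝ] ℝ) := (extChartAt 𝓘(ℝ, E₁) x₀ x₀, 0)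
  have hest : ∀ t ∈ Ico 0 τ, firstState x₀ (γ t) ∈ Metric.closedBall c (3 * r / 4) := by
    intro t ht
    have hts : t ≤ s := ht.2.le.trans hτ.1.2
    have h := norm_sub_le_of_hasDerivAt_off_finite (f := fun t ↦ firstState x₀ (γ t)) (C := C) F
      ht.1 (fun u hu ↦ (continuousAt_firstState x₀ (γ u)
          (hbefore u ⟨hu.1, hu.2.trans_lt ht.2⟩).1).comp_continuousWithinAt
          ((hγ u ⟨hu.1, hu.2.trans hts⟩).mono (Icc_subset_Icc_right hts)))
      fun u hu huF ↦ hd u ⟨hu.1, hu.2.trans_le hts⟩ huF (hbefore u ⟨hu.1.le, hu.2.trans ht.2⟩)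
    have h1 : C * (t - 0) ≤ r / 4 := le_trans (by gcongr; linarith) hCs
    have h2 := Metric.mem_ball.1 h0.2
    have h3 := dist_triangle (firstState x₀ (γ t)) (firstState x₀ (γ 0)) c
    rw [← dist_eq_norm] at h
    rw [Metric.mem_closedBall]
    linarith
  have hwithin : ContinuousWithinAt γ (Ico 0 τ) τ :=
    (hγ τ hτ.1).mono fun t ht ↦ ⟨ht.1, ht.2.le.trans hτ.1.2⟩
  have hcl : τ ∈ closure (Ico 0 τ) := by
    rw [closure_Ico hτ0.ne]
    exact right_mem_Icc.2 hτ0.le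
  have hsub : Metric.closedBall (extChartAt 𝓘(ℝ, E₁) x₀ x₀) (3 * r / 4) ⊆
      (extChartAt 𝓘(ℝ, E₁) x₀).target :=
    (Metric.closedBall_subset_ball (by linarith)).trans hball
  have : ProperSpace E₁ := FiniteDimensional.proper ℝ E₁
  have hK : IsClosed ((extChartAt 𝓘(ℝ, E₁) x₀).symm ''
      Metric.closedBall (extChartAt 𝓘(ℝ, E₁) x₀ x₀) (3 * r / 4)) :=
    ((isCompact_closedBall _ _).image_of_continuousOn
      ((continuousOn_extChartAt_symm x₀).mono hsub)).isClosed
  -- The base point at the exit time is still in the domain of the chart, as the limit of points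
  -- of the compact image of a closed ball.
  have hproj : (γ τ).proj.1 ∈ (extChartAt 𝓘(ℝ, E₁) x₀).symm ''
      Metric.closedBall (extChartAt 𝓘(ℝ, E₁) x₀ x₀) (3 * r / 4) := by
    rw [← hK.closure_eq]
    refine ((continuous_fst.comp
      continuous_proj_cotangentBundle).continuousAt.comp_continuousWithinAt hwithin).mem_closure
        hcl fun t ht ↦
      ⟨_, (le_max_left _ _).trans (Metric.mem_closedBall.1 (hest t ht)), ?_⟩
    exact (extChartAt 𝓘(ℝ, E₁) x₀).left_inv (by rw [extChartAt_source]; exact (hbefore t ht).1)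
  have hsrc : (γ τ).proj.1 ∈ (chartAt E₁ x₀).source := by
    obtain ⟨q, hq, hq'⟩ := hproj
    rw [← hq', ← extChartAt_source 𝓘(ℝ, E₁)]
    exact (extChartAt 𝓘(ℝ, E₁) x₀).map_target (hsub hq)
  refine hτ.2 ⟨hsrc, Metric.closedBall_subset_ball (by linarith : 3 * r / 4 < r) ?_⟩
  rw [← Metric.isClosed_closedBall.closure_eq]
  exact ((continuousAt_firstState x₀ (γ τ) hsrc).comp_continuousWithinAt hwithin).mem_closure hcl
    hest

variable [RiemannianBundle (fun x : N₁ ↦ TangentSpace 𝓘(ℝ, E₁) x)]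
  [RiemannianBundle (fun y : N₂ ↦ TangentSpace 𝓘(ℝ, E₂) y)]

/-- In short time, whatever the control, the first component stays in the ball of radius `r` when
it starts in the ball of radius `r / 2`. -/
theorem exists_reachable_subset_stateBall [FiniteDimensional ℝ E₁] [T2Space N₁]
    [IsContMDiffRiemannianBundle 𝓘(ℝ, E₁) 1 E₁ (fun x : N₁ ↦ TangentSpace 𝓘(ℝ, E₁) x)]
    {V W : N₁ × N₂ → ℝ} (hV : ContMDiff I₁₂ 𝓘(ℝ, ℝ) ∞ V)
    {x₀ : N₁} {U : Set N₁} (hU : U ∈ 𝓝 x₀)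
    (hW : ∀ y, ∀ x ∈ U, ∀ x' ∈ U, W (x, y) = W (x', y)) {c : ℝ}
    (hVc : ∀ x ∈ U, ∀ y, ‖partialDifferential 𝓘(ℝ, E₁) V x y‖ ≤ c) :
    ∃ r > 0, ∃ T > (0 : ℝ), Metric.closedBall (extChartAt 𝓘(ℝ, E₁) x₀ x₀) r ⊆
        (extChartAt 𝓘(ℝ, E₁) x₀).target ∩ (extChartAt 𝓘(ℝ, E₁) x₀).symm ⁻¹' U ∧
      ∀ z₀ ∈ stateBall E₂ N₂ x₀ (r / 2), ∀ T' : ℝ≥0, T' ≤ T →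
        reachableSet I₁₂ V W T' z₀ ⊆ stateBall E₂ N₂ x₀ r := by
  have : IsManifold 𝓘(ℝ, E₁) 2 N₁ := .of_le (n := ∞) (WithTop.coe_le_coe.2 le_top)
  obtain ⟨C, hC, s₁, hs₁, hkin⟩ := exists_chartKinetic_lipschitz (I := 𝓘(ℝ, E₁)) x₀ 1
  have hdiff : ∀ (y : N₂) (x : N₁), HasMFDerivAt 𝓘(ℝ, E₁) 𝓘(ℝ, ℝ) (fun x ↦ V (x, y)) x
      (partialDifferential 𝓘(ℝ, E₁) V x y) := fun y x ↦ by
    have h : ContMDiff 𝓘(ℝ, E₁) 𝓘(ℝ, ℝ) ∞ (fun x ↦ V (x, y)) :=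
      hV.comp (contMDiff_id.prodMk contMDiff_const)
    exact (h.mdifferentiable (by simp) x).hasMFDerivAt
  obtain ⟨D, hD, s₂, hs₂, hVD⟩ := exists_lipschitz_in_chart hdiff
    (mem_of_superset hU fun x hx y ↦ hVc x hx y)
  have hcont : Tendsto (extChartAt 𝓘(ℝ, E₁) x₀).symm (𝓝 (extChartAt 𝓘(ℝ, E₁) x₀ x₀)) (𝓝 x₀) := by
    have := continuousAt_extChartAt_symm (I := 𝓘(ℝ, E₁)) x₀
    rwa [ContinuousAt, extChartAt_to_inv] at this
  obtain ⟨r', hr', hsub⟩ := Metric.mem_nhds_iff.1 (inter_mem (inter_mem hs₁ hs₂)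
    (inter_mem (extChartAt_target_mem_nhds (I := 𝓘(ℝ, E₁)) x₀) (hcont hU)))
  -- `r ≤ 1` keeps the covectors in the range where the kinetic energy is known to be Lipschitz.
  let r := min (r' / 2) 1
  have hr : 0 < r := by positivity
  have hcb : Metric.closedBall (extChartAt 𝓘(ℝ, E₁) x₀ x₀) r ⊆ _ :=
    (Metric.closedBall_subset_ball ((min_le_left _ _).trans_lt (by linarith))).trans hsub
  have hb := Metric.ball_subset_closedBall.trans hcb
  refine ⟨r, hr, r / (4 * (C + D + 1)), by positivity, hcb.trans inter_subset_right,
    fun z₀ hz₀ T' hT' ↦ ?_⟩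
  rintro z ⟨s, hs, hsT, u, ⟨F, hF, hu⟩, γ, ⟨hγ, hH⟩, rfl, rfl⟩
  refine mem_stateBall_of_deriv_bound (C := C + D) (by positivity) (hb.trans fun q hq ↦ hq.2.1) hγ
    hs ?_ hF.toFinset (fun t ht htF hmem ↦ ?_) hz₀
  · have h1 : s ≤ r / (4 * (C + D + 1)) := hsT.trans hT'
    rw [le_div_iff₀ (by positivity)] at h1
    nlinarith
  · have hut := hu t (by simpa using htF)
    have hball := Metric.mem_ball.1 hmem.2
    rw [Prod.dist_eq, max_lt_iff] at hball
    refine exists_hasDerivAt_firstState (R := 1) (s := Metric.ball (extChartAt 𝓘(ℝ, E₁) x₀ x₀) r)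
      Metric.isOpen_ball (hb.trans fun q hq ↦ hq.2.1) hC hD
      (fun q hq q' hq' ↦ hkin q (hb hq).1.1 q' (hb hq').1.1)
      (fun y q hq q' hq' ↦ hVD y q (hb hq).1.2 q' (hb hq').1.2)
      (fun y q hq q' hq' ↦ hW y _ (hb hq).2.2 _ (hb hq').2.2)
      (hγ.continuousAt (Icc_mem_nhds ht.1 ht.2)) hmem.1 hball.1 ?_ (hH t ht hut)
    have := hball.2
    rw [dist_zero_right] at this
    exact this.trans_le (min_le_right _ _)

/-- A dense set of initial states meets the open set of the states whose first component is nearly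
at rest at `x₀`. From there, `x₁` remains out of reach of the first component for a short time. -/
theorem configurationDiameter_pos [FiniteDimensional ℝ E₁] [T2Space N₁] [Nonempty N₂]
    [IsContMDiffRiemannianBundle 𝓘(ℝ, E₁) 1 E₁ (fun x : N₁ ↦ TangentSpace 𝓘(ℝ, E₁) x)]
    {V W : N₁ × N₂ → ℝ} (hV : ContMDiff I₁₂ 𝓘(ℝ, ℝ) ∞ V)
    {x₀ x₁ : N₁} {U : Set N₁} (hU : U ∈ 𝓝 x₀) (hx₁ : x₁ ∉ U)
    (hW : ∀ y, ∀ x ∈ U, ∀ x' ∈ U, W (x, y) = W (x', y)) {c : ℝ}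
    (hVc : ∀ x ∈ U, ∀ y, ‖partialDifferential 𝓘(ℝ, E₁) V x y‖ ≤ c) :
    0 < configurationDiameter I₁₂ V W := by
  obtain ⟨r, hr, T, hT, hcb, hreach⟩ := exists_reachable_subset_stateBall hV hU hW hVc
  refine lt_of_lt_of_le (ENNReal.ofReal_pos.2 hT) (le_iInf₂ fun T' hT' ↦ ?_)
  rw [← ENNReal.ofReal_coe_nnreal]
  refine ENNReal.ofReal_le_ofReal (not_lt.1 fun hlt ↦ ?_)
  obtain ⟨Υ, hΥ, h⟩ := hT'
  obtain ⟨z₀, hz₀, hz₀Υ⟩ := hΥ.inter_open_nonempty _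
    (isOpen_stateBall (E₂ := E₂) (N₂ := N₂) x₀ (r / 2))
    (stateBall_nonempty x₀ (half_pos hr))
  have : ProperSpace E₁ := FiniteDimensional.proper ℝ E₁
  have hK : IsClosed ((extChartAt 𝓘(ℝ, E₁) x₀).symm ''
      Metric.closedBall (extChartAt 𝓘(ℝ, E₁) x₀ x₀) r) :=
    ((isCompact_closedBall _ _).image_of_continuousOn
      ((continuousOn_extChartAt_symm x₀).mono (hcb.trans inter_subset_left))).isClosed
  obtain ⟨y⟩ := ‹Nonempty N₂›
  obtain ⟨z, hz, hzx⟩ : (x₁, y) ∈ TotalSpace.proj '' closure (reachableSet I₁₂ V W T' z₀) := by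
    rw [h z₀ hz₀Υ]; exact mem_univ _
  have hcl := closure_minimal (t := {z : CotangentBundle I₁₂ (N₁ × N₂) | z.proj.1 ∈
      (extChartAt 𝓘(ℝ, E₁) x₀).symm '' Metric.closedBall (extChartAt 𝓘(ℝ, E₁) x₀ x₀) r})
    ((hreach z₀ hz₀ T' hlt.le).trans fun w hw ↦ ?_)
    (hK.preimage (continuous_fst.comp continuous_proj_cotangentBundle)) hz
  · obtain ⟨q, hq, hq'⟩ := hcl
    rw [hzx] at hq'
    have hU' : (extChartAt 𝓘(ℝ, E₁) x₀).symm q ∈ U := (hcb hq).2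
    rw [hq'] at hU'
    exact hx₁ hU'
  · have hball := Metric.mem_ball.1 hw.2
    rw [Prod.dist_eq, max_lt_iff] at hball
    exact ⟨_, Metric.mem_closedBall.2 hball.1.le,
      (extChartAt 𝓘(ℝ, E₁) x₀).left_inv (by rw [extChartAt_source]; exact hw.1)⟩

end Confinement

/-- Density of the reachable set in `T*M` makes the projection of its closure all of `M`. -/
theorem configurationDiameter_le {E : Type*} [NormedAddCommGroup E] [NormedSpace ℝ E]
    {H : Type*} [TopologicalSpace H] (I : ModelWithCorners ℝ E H) [I.Boundaryless]
    {M : Type*} [TopologicalSpace M] [ChartedSpace H M] [IsManifold I ∞ M]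
    [RiemannianBundle (fun x : M ↦ TangentSpace I x)] (V W : M → ℝ) :
    configurationDiameter I V W ≤ controllabilityDiameter I V W := by
  refine le_iInf₂ fun T ⟨Υ, hΥ, h⟩ ↦ iInf₂_le T ⟨Υ, hΥ, fun z₀ hz₀ ↦ ?_⟩
  rw [h z₀ hz₀, image_univ]
  exact eq_univ_of_forall fun x ↦ ⟨⟨x, 0⟩, rfl⟩

end HamiltonianControl

theorem theorem1
    {E₁ : Type*} [NormedAddCommGroup E₁] [NormedSpace ℝ E₁] [FiniteDimensional ℝ E₁]
    {E₂ : Type*} [NormedAddCommGroup E₂] [NormedSpace ℝ E₂] [FiniteDimensional ℝ E₂]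
    {N₁ : Type*} [MetricSpace N₁] [ChartedSpace E₁ N₁] [IsManifold 𝓘(ℝ, E₁) ∞ N₁]
    [RiemannianBundle (fun x : N₁ ↦ TangentSpace 𝓘(ℝ, E₁) x)]
    [IsContMDiffRiemannianBundle 𝓘(ℝ, E₁) ∞ E₁ (fun x : N₁ ↦ TangentSpace 𝓘(ℝ, E₁) x)]
    [IsRiemannianManifold 𝓘(ℝ, E₁) N₁] [CompleteSpace N₁] [ConnectedSpace N₁] [Nontrivial N₁]
    {N₂ : Type*} [MetricSpace N₂] [ChartedSpace E₂ N₂] [IsManifold 𝓘(ℝ, E₂) ∞ N₂]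
    [RiemannianBundle (fun y : N₂ ↦ TangentSpace 𝓘(ℝ, E₂) y)]
    [IsContMDiffRiemannianBundle 𝓘(ℝ, E₂) ∞ E₂ (fun y : N₂ ↦ TangentSpace 𝓘(ℝ, E₂) y)]
    [IsRiemannianManifold 𝓘(ℝ, E₂) N₂] [CompleteSpace N₂] [ConnectedSpace N₂]
    (V W : N₁ × N₂ → ℝ)
    (hV : ContMDiff (𝓘(ℝ, E₁).prod 𝓘(ℝ, E₂)) 𝓘(ℝ, ℝ) ∞ V)
    (hW : ContMDiff (𝓘(ℝ, E₁).prod 𝓘(ℝ, E₂)) 𝓘(ℝ, ℝ) ∞ W)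
    (Ω : Set N₁) (hΩ : IsOpen Ω) (hΩne : Ω.Nonempty)
    (hWΩ : ∀ y : N₂, ∀ x ∈ Ω, ∀ x' ∈ Ω, W (x, y) = W (x', y))
    (c : Ω → ℝ) (hc : ∃ K : ℝ≥0, LipschitzWith K c)
    (hVc : ∀ (x : Ω) (y : N₂),
      ‖HamiltonianControl.partialDifferential 𝓘(ℝ, E₁) V (x : N₁) y‖ ≤ c x) :
    0 < HamiltonianControl.controllabilityDiameter (𝓘(ℝ, E₁).prod 𝓘(ℝ, E₂)) V W ∧
    0 < HamiltonianControl.configurationDiameter (𝓘(ℝ, E₁).prod 𝓘(ℝ, E₂)) V W := by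
  suffices h : 0 < HamiltonianControl.configurationDiameter (𝓘(ℝ, E₁).prod 𝓘(ℝ, E₂)) V W from
    ⟨h.trans_le (HamiltonianControl.configurationDiameter_le _ V W), h⟩
  obtain ⟨x₀, hx₀⟩ := hΩne
  obtain ⟨x₁, hx₁⟩ := exists_ne x₀
  obtain ⟨K, hK⟩ := hc
  -- The unit ball makes the Lipschitz function `c` bounded by `c x₀ + K`.
  let U : Set N₁ := (Ω ∩ Metric.ball x₀ 1) ∩ {x₁}ᶜ
  have hU : U ∈ 𝓝 x₀ := inter_mem (inter_mem (hΩ.mem_nhds hx₀) (Metric.ball_mem_nhds _ one_pos))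
    (isOpen_compl_singleton.mem_nhds hx₁.symm)
  refine HamiltonianControl.configurationDiameter_pos (c := c ⟨x₀, hx₀⟩ + K) hV hU (fun h ↦ h.2 rfl)
    (fun y x hx x' hx' ↦ hWΩ y x hx.1.1 x' hx'.1.1) fun x hx y ↦ ?_
  refine (hVc ⟨x, hx.1.1⟩ y).trans ?_
  have h1 := (le_abs_self _).trans (hK.dist_le_mul ⟨x, hx.1.1⟩ ⟨x₀, hx₀⟩)
  have h2 : (K : ℝ) * dist (⟨x, hx.1.1⟩ : Ω) ⟨x₀, hx₀⟩ ≤ K * 1 :=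
    mul_le_mul_of_nonneg_left (Metric.mem_ball.1 hx.1.2).le K.2
  linarith
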